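/- Let $q>1$ be real, let $$E_q(z)=\sum_{n\ge 0}\frac{z^n}{q^{n(n-1)/2}}\quad(z\in\mathbb C),\qquad \Theta_q(z)=\sum_{n\in\mathbb Z}\frac{z^n}{q^{n(n-1)/2}}\quad(z\in\mathbb C\setminus\{0\}),$$ and call $\alpha\in\mathbb R$ *admissible* if there is $K>0$ with $|E_q(z)|\le K\exp\!\big(\tfrac{\log^2|z|}{2\log q}\big)|z|^{\alpha}$ for all $z\ne 0$. For $f$ holomorphic near $0$ put $$\tilde D_qf(z)=\frac{f(qz)-f(0)}{qz},\qquad D_{0,q}f(z)=\frac{f(0\cdot z)-f(qz)}{0\cdot z-qz}\qquad(z\neq 0),$$ extended to $z=0$ by their limit $f'(0)$. For the sequence $m_1(n)=q^{n(n-1)/2}$ let $\partial_{m_1,z}$ be the moment derivative $\partial_{m_1,z}\big(\sum_{n\ge0} a_nz^n\big)=\sum_{n\ge0}\frac{m_1(n+1)}{m_1(n)}a_{n+1}z^n$, acting on Maclaurin series. Then admissible $\alpha$ exist. Moreover, let $\alpha$ be admissible, $r>0$, $f$ holomorphic on $D(0,r)=\{|z|<r\}$, $0<\varepsilon<r$,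 $k\in\mathbb N_0$ and $$|z|<q^{-k}\varepsilon\min\{1,q^{\frac12-\alpha}\}.$$ For $|\omega|=\varepsilon$ choose a direction $\theta=\theta(\omega)\in\mathbb R$ in any way such that $\arg(\omega)+\theta\not\equiv\pi \pmod{2\pi}$ for all $\omega$ on the circle with at most countably many exceptions (for instance a constant $\theta$, for which there is exactly one exception), and let $L_\theta=[0,\infty)e^{i\theta}$. Then the Maclaurin series obtained by applying $\partial_{m_1,z}^k$ to that of $f$ converges absolutely at $z$, and its sum $\partial_{m_1,z}^kf(z)$ satisfies $$\tilde D_q^kf(z)=D_{0,q}^kf(z)=\partial_{m_1,z}^kf(z)=\frac{q}{2\pi i\log q}\oint_{|\omega|=\varepsilon}f(\omega)\int_{L_\theta}\zeta^k\,\frac{E_q(z\zeta)}{\Theta_q(q\omega\zeta)}\,d\zeta\,d\omega,$$ where the inner integral converges absolutely for every non-exceptional $\omega$ and the outer integrand is integrable on the circle. -/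

import Mathlib

noncomputable section

/-- The entire function `E_q(z) = ∑_{n ≥ 0} z^n / q^{n(n-1)/2}`. -/
def qExpE (q : ℝ) (z : ℂ) : ℂ :=
  ∑' n : ℕ, z ^ n / (q : ℂ) ^ (n * (n - 1) / 2)

/-- The Jacobi Theta function `Θ_q(z) = ∑_{n ∈ ℤ} z^n / q^{n(n-1)/2}` (for `z ≠ 0`).
The integer division is exact. -/
def jacobiThetaQ (q : ℝ) (z : ℂ) : ℂ :=
  ∑' n : ℤ, z ^ n / (q : ℂ) ^ (n * (n - 1) / 2)

/-- `α` is an admissible exponent in the growth bound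
`|E_q(z)| ≤ K exp(log²|z| / (2 log q)) |z|^α`. -/
def IsGrowthExponent (q α : ℝ) : Prop :=
  ∃ K : ℝ, 0 < K ∧ ∀ z : ℂ, z ≠ 0 →
    ‖qExpE q z‖ ≤ K * Real.exp (Real.log ‖z‖ ^ 2 / (2 * Real.log q)) * ‖z‖ ^ α

/-- The sequence `m₁(n) = q^{n(n-1)/2}`. -/
def mOne (q : ℝ) (n : ℕ) : ℝ := q ^ (n * (n - 1) / 2)

/-- The formal moment derivative
`∂_m (∑ a_n z^n) = ∑ (m(n+1)/m(n)) a_{n+1} z^n`. -/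
def momentDeriv (m : ℕ → ℝ) (φ : PowerSeries ℂ) : PowerSeries ℂ :=
  PowerSeries.mk fun n => ((m (n + 1) / m n : ℝ) : ℂ) * PowerSeries.coeff (n + 1) φ

/-- The Maclaurin series of a function. -/
def maclaurin (f : ℂ → ℂ) : PowerSeries ℂ :=
  PowerSeries.mk fun n => iteratedDeriv n f 0 / (n.factorial : ℂ)

/-- `D̃_q f(z) = (f(qz) - f(0)) / (qz)`; the value at `z = 0` is the limit `f'(0)`. -/
def tildeD (q : ℝ) (f : ℂ → ℂ) (z : ℂ) : ℂ :=
  if z = 0 then deriv f 0 else (f (q * z) - f 0) / (q * z)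

/-- The `(p,q)`-derivative `D_{p,q} f(z) = (f(pz) - f(qz)) / (pz - qz)`, `p ≠ q`;
the value at `z = 0` is the limit `f'(0)`. -/
def pqDeriv (p q : ℝ) (f : ℂ → ℂ) (z : ℂ) : ℂ :=
  if z = 0 then deriv f 0 else (f (p * z) - f (q * z)) / (p * z - q * z)

/-- Absolute convergence of the integral of `g` along the ray `L_θ = [0,∞) e^{iθ}`. -/
def RayIntegrable (θ : ℝ) (g : ℂ → ℂ) : Prop :=
  MeasureTheory.IntegrableOn
    (fun t : ℝ => g (t * Complex.exp (θ * Complex.I)) * Complex.exp (θ * Complex.I))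
    (Set.Ioi 0)

/-- The integral `∫_{L_θ} g(ζ) dζ` along the ray `L_θ = [0,∞) e^{iθ}`. -/
def rayIntegral (θ : ℝ) (g : ℂ → ℂ) : ℂ :=
  ∫ t in Set.Ioi (0 : ℝ),
    g (t * Complex.exp (θ * Complex.I)) * Complex.exp (θ * Complex.I)

/-- `arg ω + θ ≠ ±π`, read modulo `2π`: the ray `ω L_θ` is not the negative real axis. -/
def AdmissibleDirection (ω : ℂ) (θ : ℝ) : Prop :=
  ∀ n : ℤ, Complex.arg ω + θ ≠ (2 * n + 1) * Real.pi

/-- The kernel `ζ ↦ ζ^k E_q(zζ) / Θ_q(qωζ)`. -/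
def qKernel (q : ℝ) (k : ℕ) (z ω ζ : ℂ) : ℂ :=
  ζ ^ k * (qExpE q (z * ζ) / jacobiThetaQ q (q * ω * ζ))

/-- The right-hand side
`q / (2 log(q) π i) ∮_{|ω|=ε} f(ω) ∫_{L_θ} ζ^k E_q(zζ)/Θ_q(qωζ) dζ dω`,
where the direction `θ = θ(ω)` of the ray may depend on `ω`. -/
def qIntegralRep (q : ℝ) (k : ℕ) (ε : ℝ) (θ : ℂ → ℝ) (f : ℂ → ℂ) (z : ℂ) : ℂ :=
  (q : ℂ) / (2 * (Real.log q : ℂ) * (Real.pi : ℂ) * Complex.I) *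
    ∮ ω in C(0, ε), f ω * rayIntegral (θ ω) (qKernel q k z ω)

end

/-!
Cut `(0, ∞)` at the points `q ^ j`. By the quasi-periodicity `Θ_q(q x) = q x Θ_q(x)`, the integral
of `t ^ n / Θ_q(c t)` folds into an integral over the single period `(1, q]`, where the pieces add
up to `Θ_q(c t) / Θ_q(c t) = 1` against `dt / t`, times `q ^ (n (n + 1) / 2) / c ^ (n + 1)`. So each
moment is this factor times `log q`, and expanding `E_q` turns the integral of
`ζ ^ k E_q(z ζ) / Θ_q(q ω ζ)` along a ray into a geometric series, whose sum is a constant times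
`ω ^ (-k) (ω - q ^ k z)⁻¹`. The representation is thus Cauchy's formula for the Maclaurin
coefficients of `f` shifted by `k`. The denominators do not vanish, because by Jacobi's triple
product the zeros of `Θ_q` are the points `-q ^ j`.

The exponent `1 / 2` is admissible because `exp (log² x / (2 log q)) x ^ (1 / 2)` has the
quasi-periodicity of `Θ_q` on the positive axis, so the two need only be compared on `[1, q]`.
-/

open Filter Topology MeasureTheory

section ThetaTerm

/-- The general term `x ^ m / q ^ (m (m - 1) / 2)` of the theta series. It is defined over any
field, so that it serves the series of `E_q` and `Θ_q` as well as their real majorants. The integer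
division is exact. -/
def thetaTerm {K : Type*} [Field K] (q x : K) (m : ℤ) : K := x ^ m / q ^ (m * (m - 1) / 2)

theorem two_mul_triangular (m : ℤ) : 2 * (m * (m - 1) / 2) = m * (m - 1) :=
  Int.mul_ediv_cancel' (Int.even_mul_pred_self m).two_dvd

theorem triangular_add (m n : ℤ) :
    (m + n) * (m + n - 1) / 2 = m * (m - 1) / 2 + n * (n - 1) / 2 + m * n := by
  linarith [two_mul_triangular (m + n), two_mul_triangular m, two_mul_triangular n]

section Field

variable {K : Type*} [Field K] {q x : K}

theorem thetaTerm_natCast (q x : K) (n : ℕ) :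
    thetaTerm q x n = x ^ n / q ^ (n * (n - 1) / 2) := by
  have h : (n : ℤ) * (n - 1) / 2 = ((n * (n - 1) / 2 : ℕ) : ℤ) := by
    rcases n with _ | n <;> simp
  rw [thetaTerm, h, zpow_natCast, zpow_natCast]

@[simp]
theorem thetaTerm_zero (q x : K) : thetaTerm q x 0 = 1 := by
  simp [thetaTerm]

@[simp]
theorem thetaTerm_one (q x : K) : thetaTerm q x 1 = x := by
  simp [thetaTerm]

theorem thetaTerm_zero_left (q : K) {m : ℤ} (hm : m ≠ 0) : thetaTerm q 0 m = 0 := by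
  simp [thetaTerm, zero_zpow m hm]

theorem thetaTerm_ne_zero (hq : q ≠ 0) (hx : x ≠ 0) (m : ℤ) : thetaTerm q x m ≠ 0 :=
  div_ne_zero (zpow_ne_zero _ hx) (zpow_ne_zero _ hq)

theorem thetaTerm_mul (q y x : K) (m : ℤ) : thetaTerm q (y * x) m = y ^ m * thetaTerm q x m := by
  rw [thetaTerm, thetaTerm, mul_zpow, mul_div_assoc]

theorem thetaTerm_add (hq : q ≠ 0) (hx : x ≠ 0) (m n : ℤ) :
    thetaTerm q x (m + n) = thetaTerm q x m * thetaTerm q x n / q ^ (m * n) := by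
  simp only [thetaTerm, triangular_add, zpow_add₀ hq, zpow_add₀ hx]
  field_simp

theorem thetaTerm_add_one (hq : q ≠ 0) (hx : x ≠ 0) (m : ℤ) :
    thetaTerm q x (m + 1) = x / q ^ m * thetaTerm q x m := by
  rw [thetaTerm_add hq hx, thetaTerm_one, mul_one]
  ring

theorem thetaTerm_one_sub (hx : x ≠ 0) (m : ℤ) :
    thetaTerm q x (1 - m) = x * thetaTerm q x⁻¹ m := by
  have h : (1 - m) * (1 - m - 1) = m * (m - 1) := by ring
  rw [thetaTerm, thetaTerm, h, zpow_sub₀ hx, zpow_one, inv_zpow]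
  ring

theorem thetaTerm_neg_mul_thetaTerm_zpow_mul (hq : q ≠ 0) (hx : x ≠ 0) (j m : ℤ) :
    thetaTerm q x (-j) * thetaTerm q (q ^ j * x) m = thetaTerm q x (m - j) := by
  rw [thetaTerm_mul, sub_eq_add_neg, thetaTerm_add hq hx, mul_neg, zpow_neg, div_inv_eq_mul,
    mul_comm m j, zpow_mul]
  ring

theorem thetaTerm_mul_inv_thetaTerm_add (hq : q ≠ 0) (hx : x ≠ 0) (y : K) (n k : ℤ) :
    thetaTerm q y n * (thetaTerm q x (n + k))⁻¹ = (thetaTerm q x k)⁻¹ * (q ^ k * y / x) ^ n := by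
  have hy : thetaTerm q y n = (y / x) ^ n * thetaTerm q x n := by
    rw [← thetaTerm_mul, div_mul_cancel₀ y hx]
  have h := thetaTerm_ne_zero hq hx n
  rw [thetaTerm_add hq hx, hy, mul_div_assoc (q ^ k) y x, mul_zpow, ← zpow_mul, mul_comm k n]
  field_simp

end Field

theorem thetaTerm_neg_mul_tsum_thetaTerm {K : Type*} [Field K] [TopologicalSpace K] [T2Space K]
    [IsTopologicalSemiring K] {q x : K} (hq : q ≠ 0) (hx : x ≠ 0) (j : ℤ) :
    thetaTerm q x (-j) * ∑' m : ℤ, thetaTerm q (q ^ j * x) m = ∑' m : ℤ, thetaTerm q x m := by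
  rw [← tsum_mul_left]
  simp only [thetaTerm_neg_mul_thetaTerm_zpow_mul hq hx]
  exact (Equiv.subRight j).tsum_eq fun m => thetaTerm q x m

section Real

variable {q x : ℝ}

theorem thetaTerm_nonneg (hq : 0 ≤ q) (hx : 0 ≤ x) (m : ℤ) : 0 ≤ thetaTerm q x m :=
  div_nonneg (zpow_nonneg hx m) (zpow_nonneg hq _)

theorem ofReal_thetaTerm (q x : ℝ) (m : ℤ) :
    ((thetaTerm q x m : ℝ) : ℂ) = thetaTerm (q : ℂ) x m := by
  simp [thetaTerm]

theorem thetaTerm_le_add_of_mem_Icc {a b : ℝ} (hq : 0 ≤ q) (ha : 0 < a) (hx : x ∈ Set.Icc a b)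
    (m : ℤ) : thetaTerm q x m ≤ thetaTerm q a m + thetaTerm q b m := by
  have hx0 : 0 < x := ha.trans_le hx.1
  have hqm : 0 ≤ q ^ (m * (m - 1) / 2) := zpow_nonneg hq _
  rcases le_total 0 m with hm | hm
  · refine le_add_of_nonneg_of_le (thetaTerm_nonneg hq ha.le m) ?_
    exact div_le_div_of_nonneg_right (zpow_le_zpow_left₀ hm hx0.le hx.2) hqm
  · refine le_add_of_le_of_nonneg ?_ (thetaTerm_nonneg hq (hx0.le.trans hx.2) m)
    have hpow : x ^ m ≤ a ^ m := by
      rw [← inv_le_inv₀ (zpow_pos ha m) (zpow_pos hx0 m), ← zpow_neg, ← zpow_neg]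
      exact zpow_le_zpow_left₀ (neg_nonneg.2 hm) ha.le hx.1
    exact div_le_div_of_nonneg_right hpow hqm

end Real

section NormedField

variable {K : Type*} [NormedField K] {q : K}

theorem norm_thetaTerm (q x : K) (m : ℤ) : ‖thetaTerm q x m‖ = thetaTerm ‖q‖ ‖x‖ m := by
  simp [thetaTerm]

theorem summable_norm_thetaTerm_natCast (hq : 1 < ‖q‖) {x : K} (hx : x ≠ 0) :
    Summable fun n : ℕ => ‖thetaTerm q x n‖ := by
  have hq0 : q ≠ 0 := norm_pos_iff.1 (zero_lt_one.trans hq)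
  have hterm (n : ℕ) : thetaTerm q x n ≠ 0 := thetaTerm_ne_zero hq0 hx n
  refine summable_of_ratio_test_tendsto_lt_one zero_lt_one
    (Eventually.of_forall fun n => norm_ne_zero_iff.2 (hterm n)) ?_
  have hratio (n : ℕ) :
      ‖‖thetaTerm q x (n + 1 : ℕ)‖‖ / ‖‖thetaTerm q x n‖‖ = ‖x‖ * ‖q‖⁻¹ ^ n := by
    rw [norm_norm, norm_norm, ← norm_div, Nat.cast_succ, thetaTerm_add_one hq0 hx,
      mul_div_cancel_right₀ _ (hterm n), norm_div, norm_zpow, zpow_natCast, inv_pow, div_eq_mul_inv]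
  simp only [hratio]
  simpa only [mul_zero] using (tendsto_pow_atTop_nhds_zero_of_lt_one (by positivity)
    (inv_lt_one_of_one_lt₀ hq)).const_mul ‖x‖

theorem summable_norm_thetaTerm (hq : 1 < ‖q‖) (x : K) :
    Summable fun m : ℤ => ‖thetaTerm q x m‖ := by
  rcases eq_or_ne x 0 with rfl | hx
  · refine summable_of_ne_finset_zero (s := {0}) fun m hm => ?_
    rw [thetaTerm_zero_left q (by simpa using hm), norm_zero]
  refine Summable.of_nat_of_neg_add_one (summable_norm_thetaTerm_natCast hq hx) ?_
  have hneg (n : ℕ) :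
      ‖thetaTerm q x (-(n + 1 : ℤ))‖ = ‖x‖ * ‖thetaTerm q x⁻¹ ((n + 2 : ℕ) : ℤ)‖ := by
    rw [← norm_mul, ← thetaTerm_one_sub hx]
    congr 2
  simp only [hneg]
  exact ((summable_nat_add_iff 2).2
    (summable_norm_thetaTerm_natCast hq (inv_ne_zero hx))).mul_left ‖x‖

end NormedField

theorem summable_thetaTerm_real {q x : ℝ} (hq : 1 < q) (hx : 0 ≤ x) :
    Summable fun m : ℤ => thetaTerm q x m := by
  have hq0 : 0 ≤ q := zero_le_one.trans hq.le
  refine (summable_norm_thetaTerm (q := q) (by rwa [Real.norm_of_nonneg hq0]) x).congr fun m => ?_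
  exact Real.norm_of_nonneg (thetaTerm_nonneg hq0 hx m)

end ThetaTerm

section ThetaFunction

variable {q : ℝ}

theorem norm_thetaTerm_ofReal (hq : 0 ≤ q) (z : ℂ) (m : ℤ) :
    ‖thetaTerm (q : ℂ) z m‖ = thetaTerm q ‖z‖ m := by
  rw [norm_thetaTerm, Complex.norm_of_nonneg hq]

theorem one_lt_norm_ofReal (hq : 1 < q) : 1 < ‖(q : ℂ)‖ := by
  rwa [Complex.norm_of_nonneg (zero_le_one.trans hq.le)]

theorem hasSum_jacobiThetaQ (hq : 1 < q) (z : ℂ) :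
    HasSum (thetaTerm (q : ℂ) z) (jacobiThetaQ q z) :=
  (summable_norm_thetaTerm (one_lt_norm_ofReal hq) z).of_norm.hasSum

theorem hasSum_qExpE (hq : 1 < q) (z : ℂ) :
    HasSum (fun n : ℕ => thetaTerm (q : ℂ) z n) (qExpE q z) := by
  have h : Summable fun n : ℕ => thetaTerm (q : ℂ) z n :=
    (summable_norm_thetaTerm (one_lt_norm_ofReal hq) z).of_norm.comp_injective Nat.cast_injective
  simpa only [qExpE, thetaTerm_natCast] using h.hasSum

theorem hasSum_pow_mul_qExpE_mul (hq : 1 < q) (a : ℂ) (k : ℕ) (t w : ℂ) :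
    HasSum (fun n : ℕ => thetaTerm (q : ℂ) a n * (t ^ (n + k) * w))
      (t ^ k * qExpE q (a * t) * w) := by
  rw [mul_comm a t]
  refine (((hasSum_qExpE hq (t * a)).mul_left (t ^ k)).mul_right w).congr_fun fun n => ?_
  rw [thetaTerm_mul, zpow_natCast]
  ring

theorem thetaTerm_neg_mul_jacobiThetaQ (hq : 1 < q) {z : ℂ} (hz : z ≠ 0) (j : ℤ) :
    thetaTerm (q : ℂ) z (-j) * jacobiThetaQ q ((q : ℂ) ^ j * z) = jacobiThetaQ q z :=
  thetaTerm_neg_mul_tsum_thetaTerm (Complex.ofReal_ne_zero.2 (zero_lt_one.trans hq).ne') hz j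

theorem continuousOn_jacobiThetaQ_annulus (hq : 1 < q) {a b : ℝ} (ha : 0 < a) (hab : a ≤ b) :
    ContinuousOn (jacobiThetaQ q) {z | ‖z‖ ∈ Set.Icc a b} := by
  have hq0 : 0 ≤ q := zero_le_one.trans hq.le
  refine continuousOn_tsum (f := fun m z => thetaTerm (q : ℂ) z m) (fun m z hz => ?_)
    ((summable_thetaTerm_real hq ha.le).add (summable_thetaTerm_real hq (ha.le.trans hab)))
    fun m z hz => ?_
  · have hz0 : z ≠ 0 := norm_pos_iff.1 (ha.trans_le hz.1)
    exact ((continuousAt_zpow₀ z m (Or.inl hz0)).div_const _).continuousWithinAt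
  · rw [norm_thetaTerm_ofReal hq0]
    exact thetaTerm_le_add_of_mem_Icc hq0 ha hz m

theorem continuousOn_jacobiThetaQ (hq : 1 < q) : ContinuousOn (jacobiThetaQ q) {0}ᶜ := by
  intro z hz
  have hz0 : 0 < ‖z‖ := norm_pos_iff.2 hz
  have hlt : ‖z‖ / 2 < ‖z‖ ∧ ‖z‖ < 2 * ‖z‖ := ⟨by linarith, by linarith⟩
  refine ((continuousOn_jacobiThetaQ_annulus hq (half_pos hz0)
    (hlt.1.trans hlt.2).le).continuousAt ?_).continuousWithinAt
  exact continuous_norm.continuousAt (Icc_mem_nhds hlt.1 hlt.2)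

end ThetaFunction

section TripleProduct

/-- The finite Euler product `(p; p)_n = ∏_{i < n} (1 - p ^ (i + 1))`. -/
def eulerProd {K : Type*} [Field K] (p : K) (n : ℕ) : K :=
  ∏ i ∈ Finset.range n, (1 - p ^ (i + 1))

/-- The reciprocal `1 / (p; p)_m`. Extending it by zero to negative `m` keeps the recursion
`invEulerProd_sub_one` valid for all integers and makes `gaussBinom` vanish outside `0 ≤ k ≤ n`. -/
def invEulerProd {K : Type*} [Field K] (p : K) : ℤ → K
  | Int.ofNat n => (eulerProd p n)⁻¹
  | Int.negSucc _ => 0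

/-- The Gaussian binomial coefficient with base `p`, extended by zero to all integers `k`. -/
def gaussBinom {K : Type*} [Field K] (p : K) (n : ℕ) (k : ℤ) : K :=
  eulerProd p n * (invEulerProd p k * invEulerProd p (n - k))

section Field

variable {K : Type*} [Field K] {p : K}

theorem eulerProd_succ (p : K) (n : ℕ) :
    eulerProd p (n + 1) = eulerProd p n * (1 - p ^ (n + 1)) :=
  Finset.prod_range_succ _ n

theorem invEulerProd_natCast (p : K) (n : ℕ) : invEulerProd p n = (eulerProd p n)⁻¹ := rfl

theorem invEulerProd_of_neg (p : K) {m : ℤ} (hm : m < 0) : invEulerProd p m = 0 := by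
  obtain ⟨n, rfl⟩ := Int.eq_negSucc_of_lt_zero hm
  rfl

theorem invEulerProd_sub_one (hp : ∀ n : ℕ, p ^ (n + 1) ≠ 1) (m : ℤ) :
    invEulerProd p (m - 1) = (1 - p ^ m) * invEulerProd p m := by
  rcases lt_trichotomy m 0 with hm | rfl | hm
  · rw [invEulerProd_of_neg p hm, invEulerProd_of_neg p (by lia), mul_zero]
  · rw [invEulerProd_of_neg p (by lia), zpow_zero, sub_self, zero_mul]
  · obtain ⟨n, rfl⟩ := Int.eq_succ_of_zero_lt hm
    rw [← Nat.cast_succ, zpow_natCast, Nat.cast_succ, add_sub_cancel_right, ← Nat.cast_succ,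
      invEulerProd_natCast, invEulerProd_natCast, eulerProd_succ]
    field_simp [sub_ne_zero.2 (hp n).symm]

theorem gaussBinom_zero_zero (p : K) : gaussBinom p 0 0 = 1 := by
  simp [gaussBinom, invEulerProd, eulerProd]

theorem gaussBinom_zero_of_ne_zero (p : K) {k : ℤ} (hk : k ≠ 0) : gaussBinom p 0 k = 0 := by
  rcases hk.lt_or_gt with hk | hk
  · rw [gaussBinom, invEulerProd_of_neg p hk, zero_mul, mul_zero]
  · rw [gaussBinom, invEulerProd_of_neg p (by lia : ((0 : ℕ) : ℤ) - k < 0), mul_zero, mul_zero]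

theorem gaussBinom_symm (p : K) (n : ℕ) (k : ℤ) : gaussBinom p n (n - k) = gaussBinom p n k := by
  rw [gaussBinom, sub_sub_cancel, mul_comm (invEulerProd p _), gaussBinom]

theorem gaussBinom_succ (hp0 : p ≠ 0) (hp : ∀ n : ℕ, p ^ (n + 1) ≠ 1) (n : ℕ) (k : ℤ) :
    gaussBinom p (n + 1) k = gaussBinom p n k + p ^ (n + 1 - k) * gaussBinom p n (k - 1) := by
  have hpow : p ^ (n + 1) = p ^ ((n : ℤ) + 1 - k) * p ^ k := by
    rw [← zpow_add₀ hp0, sub_add_cancel]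
    exact_mod_cast rfl
  have hk : (n : ℤ) - k = n + 1 - k - 1 := by ring
  have hk' : (n : ℤ) - (k - 1) = n + 1 - k := by ring
  simp only [gaussBinom, eulerProd_succ, hk, hk', invEulerProd_sub_one hp, Nat.cast_succ, hpow]
  ring

theorem gaussBinom_succ' (hp0 : p ≠ 0) (hp : ∀ n : ℕ, p ^ (n + 1) ≠ 1) (n : ℕ) (k : ℤ) :
    gaussBinom p (n + 1) k = gaussBinom p n (k - 1) + p ^ k * gaussBinom p n k := by
  have hk : ((n + 1 : ℕ) : ℤ) - k = n - (k - 1) := by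
    push_cast
    ring
  have hk' : (n : ℤ) - (k - 1) - 1 = n - k := by ring
  rw [← gaussBinom_symm, gaussBinom_succ hp0 hp, hk, hk', gaussBinom_symm, gaussBinom_symm]
  congr 3
  ring

theorem mul_inv_pow_mul_thetaTerm_sub_one {q z : K} (hq : q ≠ 0) (hz : z ≠ 0) (n : ℕ) (m : ℤ) :
    z * q⁻¹ ^ n * thetaTerm q z (m - 1) = q⁻¹ ^ (n + 1 - m) * thetaTerm q z m := by
  have h := thetaTerm_add_one hq hz (m - 1)
  rw [sub_add_cancel] at h
  have hn : (n : ℤ) + 1 - m = n - (m - 1) := by ring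
  rw [h, hn, zpow_sub₀ (inv_ne_zero hq), zpow_natCast, inv_zpow q (m - 1)]
  field_simp

theorem inv_mul_inv_pow_mul_thetaTerm_add_one {q z : K} (hq : q ≠ 0) (hz : z ≠ 0) (n : ℕ) (m : ℤ) :
    z⁻¹ * q⁻¹ ^ (n + 1) * thetaTerm q z (m + 1) = q⁻¹ ^ (n + 1 + m) * thetaTerm q z m := by
  rw [thetaTerm_add_one hq hz, zpow_add₀ (inv_ne_zero hq), inv_zpow q m]
  have h : q⁻¹ ^ ((n : ℤ) + 1) = q⁻¹ ^ (n + 1) := by exact_mod_cast rfl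
  rw [h]
  field_simp

end Field

section NormedField

variable {K : Type*} [NormedField K] {q z p : K}

theorem pow_succ_ne_one_of_norm_lt_one (hp : ‖p‖ < 1) (n : ℕ) : p ^ (n + 1) ≠ 1 := fun h =>
  (pow_lt_one₀ (norm_nonneg p) hp n.succ_ne_zero).ne (by rw [← norm_pow, h, norm_one])

theorem norm_inv_lt_one_of_one_lt_norm (hq : 1 < ‖q‖) : ‖q⁻¹‖ < 1 := by
  rw [norm_inv]
  exact inv_lt_one_of_one_lt₀ hq

theorem hasSum_gaussBinom_succ_left (hq : 1 < ‖q‖) (hz : z ≠ 0) {M N : ℕ} {P : K}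
    (h : HasSum (fun m : ℤ => gaussBinom q⁻¹ (M + N) (m + N) * thetaTerm q z m) P) :
    HasSum (fun m : ℤ => gaussBinom q⁻¹ (M + 1 + N) (m + N) * thetaTerm q z m)
      (P * (1 + z * q⁻¹ ^ M)) := by
  have hq0 : q ≠ 0 := norm_pos_iff.1 (zero_lt_one.trans hq)
  have hp := pow_succ_ne_one_of_norm_lt_one (norm_inv_lt_one_of_one_lt_norm hq)
  have hshift := ((Equiv.subRight (1 : ℤ)).hasSum_iff.2 h).mul_left (z * q⁻¹ ^ M)
  rw [mul_one_add, mul_comm P (z * _)]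
  refine (h.add hshift).congr_fun fun m => ?_
  have hk : (m - 1 : ℤ) + N = m + N - 1 := by ring
  have hexp : ((M + N : ℕ) : ℤ) + 1 - (m + N) = M + 1 - m := by
    push_cast
    ring
  rw [add_right_comm M, gaussBinom_succ (inv_ne_zero hq0) hp, hexp, Function.comp_apply,
    Equiv.subRight_apply, hk]
  linear_combination -gaussBinom q⁻¹ (M + N) (m + N - 1) *
    mul_inv_pow_mul_thetaTerm_sub_one hq0 hz M m

theorem hasSum_gaussBinom_succ_right (hq : 1 < ‖q‖) (hz : z ≠ 0) {M N : ℕ} {P : K}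
    (h : HasSum (fun m : ℤ => gaussBinom q⁻¹ (M + N) (m + N) * thetaTerm q z m) P) :
    HasSum (fun m : ℤ => gaussBinom q⁻¹ (M + (N + 1)) (m + (N + 1 : ℕ)) * thetaTerm q z m)
      (P * (1 + z⁻¹ * q⁻¹ ^ (N + 1))) := by
  have hq0 : q ≠ 0 := norm_pos_iff.1 (zero_lt_one.trans hq)
  have hp := pow_succ_ne_one_of_norm_lt_one (norm_inv_lt_one_of_one_lt_norm hq)
  have hshift := ((Equiv.addRight (1 : ℤ)).hasSum_iff.2 h).mul_left (z⁻¹ * q⁻¹ ^ (N + 1))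
  rw [mul_one_add, mul_comm P (z⁻¹ * _)]
  refine (h.add hshift).congr_fun fun m => ?_
  have hk : (m + 1 : ℤ) + N = m + (N + 1 : ℕ) := by
    push_cast
    ring
  have hk' : m + ((N + 1 : ℕ) : ℤ) - 1 = m + N := by
    push_cast
    ring
  have hexp : (N : ℤ) + 1 + m = m + (N + 1 : ℕ) := by
    push_cast
    ring
  have hterm := inv_mul_inv_pow_mul_thetaTerm_add_one hq0 hz N m
  rw [hexp] at hterm
  rw [← add_assoc M, gaussBinom_succ' (inv_ne_zero hq0) hp, hk', Function.comp_apply,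
    Equiv.coe_addRight, hk]
  linear_combination -gaussBinom q⁻¹ (M + N) (m + (N + 1 : ℕ)) * hterm

theorem hasSum_finite_tripleProduct (hq : 1 < ‖q‖) (hz : z ≠ 0) (M N : ℕ) :
    HasSum (fun m : ℤ => gaussBinom q⁻¹ (M + N) (m + N) * thetaTerm q z m)
      ((∏ j ∈ Finset.range M, (1 + z * q⁻¹ ^ j)) *
        ∏ j ∈ Finset.range N, (1 + z⁻¹ * q⁻¹ ^ (j + 1))) := by
  induction N with
  | zero =>
    induction M with
    | zero =>
      have h := hasSum_single (f := fun m : ℤ => gaussBinom q⁻¹ 0 m * thetaTerm q z m) 0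
        fun m hm => by rw [gaussBinom_zero_of_ne_zero _ hm, zero_mul]
      simpa [gaussBinom_zero_zero] using h
    | succ M ih =>
      simpa only [Finset.prod_range_succ, Finset.prod_range_zero, mul_one] using
        hasSum_gaussBinom_succ_left hq hz ih
  | succ N ih =>
    simpa only [Finset.prod_range_succ _ N, mul_assoc] using hasSum_gaussBinom_succ_right hq hz ih

theorem summable_norm_mul_inv_pow (hq : 1 < ‖q‖) (z : K) :
    Summable fun j : ℕ => ‖z * q⁻¹ ^ j‖ := by
  simpa only [norm_mul, norm_pow] using (summable_geometric_of_lt_one (norm_nonneg _)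
    (norm_inv_lt_one_of_one_lt_norm hq)).mul_left ‖z‖

theorem summable_norm_mul_inv_pow_succ (hq : 1 < ‖q‖) (z : K) :
    Summable fun j : ℕ => ‖z * q⁻¹ ^ (j + 1)‖ :=
  (summable_norm_mul_inv_pow hq z).comp_injective (add_left_injective 1)

theorem tendsto_invEulerProd {T : K} (hT : T ≠ 0) (h : Tendsto (eulerProd p) atTop (𝓝 T)) :
    Tendsto (invEulerProd p) atTop (𝓝 T⁻¹) := by
  have hnat : Tendsto (fun n : ℤ => (eulerProd p n.toNat)⁻¹) atTop (𝓝 T⁻¹) :=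
    (h.comp (tendsto_atTop_atTop.2 fun b : ℕ => ⟨(b : ℤ), fun a ha => by lia⟩ :
      Tendsto Int.toNat atTop atTop)).inv₀ hT
  refine hnat.congr' ?_
  filter_upwards [eventually_ge_atTop 0] with n hn
  lift n to ℕ using hn
  rfl

theorem exists_norm_invEulerProd_le {T : K} (hT : T ≠ 0) (h : Tendsto (eulerProd p) atTop (𝓝 T)) :
    ∃ C, ∀ m, ‖invEulerProd p m‖ ≤ C := by
  obtain ⟨C, hC⟩ := (h.inv₀ hT).norm.bddAbove_range
  refine ⟨C, fun m => ?_⟩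
  rcases lt_or_ge m 0 with hm | hm
  · rw [invEulerProd_of_neg p hm, norm_zero]
    exact (norm_nonneg _).trans (hC ⟨0, rfl⟩)
  · lift m to ℕ using hm
    exact hC ⟨m, rfl⟩

theorem tendsto_gaussBinom {T : K} (hT : T ≠ 0) (h : Tendsto (eulerProd p) atTop (𝓝 T)) (m : ℤ) :
    Tendsto (fun N : ℕ => gaussBinom p (N + N) (m + N)) atTop (𝓝 T⁻¹) := by
  have hN : Tendsto (fun N : ℕ => (N : ℤ)) atTop atTop := tendsto_natCast_atTop_atTop
  have hR := tendsto_invEulerProd hT h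
  have hlim := (h.comp (tendsto_id.atTop_add_atTop tendsto_id)).mul
    ((hR.comp (tendsto_atTop_add_const_left _ m hN)).mul
      (hR.comp (tendsto_atTop_add_const_left _ (-m) hN)))
  rw [mul_inv_cancel_left₀ hT] at hlim
  refine hlim.congr fun N => ?_
  have hk : ((N + N : ℕ) : ℤ) - (m + N) = -m + N := by
    push_cast
    ring
  simp only [gaussBinom, hk, Function.comp_apply, id_eq]

theorem exists_norm_gaussBinom_le {T : K} (hT : T ≠ 0) (h : Tendsto (eulerProd p) atTop (𝓝 T)) :
    ∃ C, ∀ n k, ‖gaussBinom p n k‖ ≤ C := by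
  obtain ⟨A, hA⟩ := h.norm.bddAbove_range
  obtain ⟨B, hB⟩ := exists_norm_invEulerProd_le hT h
  have hB0 : 0 ≤ B := (norm_nonneg _).trans (hB 0)
  refine ⟨A * (B * B), fun n k => ?_⟩
  have hn : ‖eulerProd p n‖ ≤ A := hA ⟨n, rfl⟩
  have hA0 : 0 ≤ A := (norm_nonneg _).trans hn
  rw [gaussBinom, norm_mul, norm_mul]
  gcongr
  exacts [hB _, hB _]

variable [CompleteSpace K]

theorem tendsto_eulerProd (hq : 1 < ‖q‖) :
    Tendsto (eulerProd q⁻¹) atTop (𝓝 (∏' i : ℕ, (1 - q⁻¹ ^ (i + 1)))) := by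
  have h := (multipliable_one_add_of_summable
    (summable_norm_mul_inv_pow_succ hq (-1))).hasProd.tendsto_prod_nat
  simp only [neg_one_mul, ← sub_eq_add_neg] at h
  exact h

theorem tprod_one_sub_inv_pow_succ_ne_zero (hq : 1 < ‖q‖) :
    ∏' i : ℕ, (1 - q⁻¹ ^ (i + 1)) ≠ 0 := by
  simp only [sub_eq_add_neg, ← neg_one_mul (q⁻¹ ^ _)]
  refine tprod_one_add_ne_zero_of_summable (fun i h => ?_) (summable_norm_mul_inv_pow_succ hq (-1))
  refine pow_succ_ne_one_of_norm_lt_one (norm_inv_lt_one_of_one_lt_norm hq) i ?_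
  linear_combination -h

theorem jacobi_tripleProduct (hq : 1 < ‖q‖) (hz : z ≠ 0) :
    (∏' i : ℕ, (1 - q⁻¹ ^ (i + 1))) * (∏' j : ℕ, (1 + z * q⁻¹ ^ j)) *
      (∏' j : ℕ, (1 + z⁻¹ * q⁻¹ ^ (j + 1))) = ∑' m : ℤ, thetaTerm q z m := by
  have hT := tprod_one_sub_inv_pow_succ_ne_zero hq
  have hlim := tendsto_eulerProd hq
  obtain ⟨C, hC⟩ := exists_norm_gaussBinom_le hT hlim
  have hsum : Tendsto (fun N : ℕ => ∑' m : ℤ, gaussBinom q⁻¹ (N + N) (m + N) * thetaTerm q z m)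
      atTop (𝓝 (∑' m : ℤ, (∏' i : ℕ, (1 - q⁻¹ ^ (i + 1)))⁻¹ * thetaTerm q z m)) := by
    refine tendsto_tsum_of_dominated_convergence ((summable_norm_thetaTerm hq z).mul_left C)
      (fun m => (tendsto_gaussBinom hT hlim m).mul_const _) (Eventually.of_forall fun N m => ?_)
    rw [norm_mul]
    exact mul_le_mul_of_nonneg_right (hC _ _) (norm_nonneg _)
  simp only [(hasSum_finite_tripleProduct hq hz _ _).tsum_eq, tsum_mul_left] at hsum
  have hprod := (multipliable_one_add_of_summable
    (summable_norm_mul_inv_pow hq z)).hasProd.tendsto_prod_nat.mul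
      (multipliable_one_add_of_summable
        (summable_norm_mul_inv_pow_succ hq z⁻¹)).hasProd.tendsto_prod_nat
  rw [mul_assoc, tendsto_nhds_unique hprod hsum, mul_inv_cancel_left₀ hT]

theorem tsum_thetaTerm_ne_zero (hq : 1 < ‖q‖) (hz : z ≠ 0) (hzq : ∀ j : ℤ, z ≠ -q ^ j) :
    ∑' m : ℤ, thetaTerm q z m ≠ 0 := by
  have hq0 : q ≠ 0 := norm_pos_iff.1 (zero_lt_one.trans hq)
  rw [← jacobi_tripleProduct hq hz]
  refine mul_ne_zero (mul_ne_zero (tprod_one_sub_inv_pow_succ_ne_zero hq)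
    (tprod_one_add_ne_zero_of_summable (fun j h => hzq j ?_) (summable_norm_mul_inv_pow hq z)))
    (tprod_one_add_ne_zero_of_summable (fun j h => hzq (-(j + 1 : ℕ)) ?_)
      (summable_norm_mul_inv_pow_succ hq z⁻¹))
  · rw [zpow_natCast]
    rw [inv_pow] at h
    field_simp at h
    linear_combination h
  · rw [zpow_neg, zpow_natCast]
    rw [inv_pow] at h
    field_simp at h ⊢
    linear_combination h

end NormedField

end TripleProduct

section Unfolding

variable {E : Type*} [NormedAddCommGroup E] {q : ℝ} {F : ℝ → E}

theorem iUnion_Ioc_zpow (hq : 1 < q) : ⋃ j : ℤ, Set.Ioc (q ^ j) (q ^ (j + 1)) = Set.Ioi 0 := by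
  ext x
  simp only [Set.mem_iUnion, Set.mem_Ioi]
  exact ⟨fun ⟨j, hj⟩ => (zpow_pos (zero_lt_one.trans hq) j).trans hj.1,
    fun hx => exists_mem_Ioc_zpow hx hq⟩

theorem pairwise_disjoint_Ioc_zpow (hq : 1 < q) :
    Pairwise (Function.onFun Disjoint fun j : ℤ => Set.Ioc (q ^ j) (q ^ (j + 1))) :=
  (zpow_right_mono₀ hq.le).pairwise_disjoint_on_Ioc_succ

variable [NormedSpace ℝ E]

theorem setIntegral_Ioc_zpow (hq : 1 < q) (F : ℝ → E) (j : ℤ) :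
    ∫ t in Set.Ioc (q ^ j) (q ^ (j + 1)), F t = ∫ s in (1 : ℝ)..q, q ^ j • F (q ^ j * s) := by
  rw [← intervalIntegral.integral_of_le (zpow_le_zpow_right₀ hq.le (lt_add_one j).le),
    intervalIntegral.integral_smul, intervalIntegral.smul_integral_comp_mul_left, mul_one,
    zpow_add_one₀ (zero_lt_one.trans hq).ne']

theorem continuousOn_zpow_smul_comp_zpow_mul (hq : 0 < q) (hF : ContinuousOn F (Set.Ioi 0))
    (j : ℤ) : ContinuousOn (fun s => q ^ j • F (q ^ j * s)) (Set.Ioi 0) :=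
  (hF.comp (by fun_prop) fun _ hs => mul_pos (zpow_pos hq j) hs).const_smul _

theorem integrableOn_Ioi_of_summable_bound (hq : 1 < q) {b : ℤ → ℝ}
    (hF : ContinuousOn F (Set.Ioi 0)) (hb : Summable b)
    (hbound : ∀ j, ∀ s ∈ Set.Icc 1 q, ‖q ^ j • F (q ^ j * s)‖ ≤ b j) :
    IntegrableOn F (Set.Ioi 0) := by
  have hq0 : 0 < q := zero_lt_one.trans hq
  have hIcc : Set.Icc 1 q ⊆ Set.Ioi 0 := fun s hs => zero_lt_one.trans_le hs.1
  have hpiece (j : ℤ) : IntegrableOn F (Set.Ioc (q ^ j) (q ^ (j + 1))) :=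
    ((hF.mono fun t ht => (zpow_pos hq0 j).trans_le ht.1).integrableOn_Icc).mono_set
      Set.Ioc_subset_Icc_self
  have hnorm (j : ℤ) : ∫ t in Set.Ioc (q ^ j) (q ^ (j + 1)), ‖F t‖ ≤ b j * (q - 1) :=
    calc ∫ t in Set.Ioc (q ^ j) (q ^ (j + 1)), ‖F t‖
        = ∫ s in (1 : ℝ)..q, q ^ j • ‖F (q ^ j * s)‖ := setIntegral_Ioc_zpow hq _ j
      _ ≤ ∫ _ in (1 : ℝ)..q, b j := by
          refine intervalIntegral.integral_mono_on hq.le ?_ intervalIntegrable_const fun s hs => ?_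
          · exact (((continuousOn_zpow_smul_comp_zpow_mul hq0 hF.norm j).mono hIcc).mono
              (Set.uIcc_of_le hq.le).subset).intervalIntegrable
          · simpa only [norm_smul, Real.norm_of_nonneg (zpow_pos hq0 j).le, smul_eq_mul] using
              hbound j s hs
      _ = b j * (q - 1) := by rw [intervalIntegral.integral_const, smul_eq_mul, mul_comm]
  rw [← iUnion_Ioc_zpow hq]
  exact integrableOn_iUnion_of_summable_integral_norm hpiece
    ((hb.mul_right (q - 1)).of_nonneg_of_le (fun j => integral_nonneg fun _ => norm_nonneg _) hnorm)

theorem integral_Ioi_eq_intervalIntegral_of_hasSum (hq : 1 < q) {b : ℤ → ℝ} {G : ℝ → E}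
    (hF : ContinuousOn F (Set.Ioi 0)) (hb : Summable b)
    (hbound : ∀ j, ∀ s ∈ Set.Icc 1 q, ‖q ^ j • F (q ^ j * s)‖ ≤ b j)
    (hsum : ∀ s ∈ Set.Icc 1 q, HasSum (fun j : ℤ => q ^ j • F (q ^ j * s)) (G s)) :
    ∫ t in Set.Ioi 0, F t = ∫ s in (1 : ℝ)..q, G s := by
  have hq0 : 0 < q := zero_lt_one.trans hq
  have hIcc {s : ℝ} (hs : s ∈ Set.uIoc 1 q) : s ∈ Set.Icc 1 q :=
    Set.Ioc_subset_Icc_self (Set.uIoc_of_le hq.le ▸ hs)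
  have hpieces : HasSum (fun j : ℤ => ∫ t in Set.Ioc (q ^ j) (q ^ (j + 1)), F t)
      (∫ t in Set.Ioi 0, F t) := by
    have hint := integrableOn_Ioi_of_summable_bound hq hF hb hbound
    rw [← iUnion_Ioc_zpow hq] at hint ⊢
    exact hasSum_integral_iUnion (fun _ => measurableSet_Ioc) (pairwise_disjoint_Ioc_zpow hq) hint
  simp only [setIntegral_Ioc_zpow hq] at hpieces
  refine hpieces.unique (intervalIntegral.hasSum_integral_of_dominated_convergence (fun j _ => b j)
    (fun j => ?_) (fun j => Eventually.of_forall fun s hs => hbound j s (hIcc hs))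
    (Eventually.of_forall fun s _ => hb) intervalIntegrable_const
    (Eventually.of_forall fun s hs => hsum s (hIcc hs)))
  exact ((continuousOn_zpow_smul_comp_zpow_mul hq0 hF j).mono
    fun s hs => zero_lt_one.trans_le (hIcc hs).1).aestronglyMeasurable measurableSet_uIoc

end Unfolding

section SeriesIntegral

variable {α E ι : Type*} [MeasurableSpace α] {μ : Measure α} [NormedAddCommGroup E] [Countable ι]

theorem integrable_of_hasSum_of_summable_integral_norm {F : ι → α → E} {g : α → E}
    (hF : ∀ i, Integrable (F i) μ) (hsummable : Summable fun i => ∫ a, ‖F i a‖ ∂μ)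
    (hg : ∀ᵐ a ∂μ, HasSum (fun i => F i a) (g a)) : Integrable g μ := by
  have hmeas : AEStronglyMeasurable g μ :=
    aestronglyMeasurable_of_tendsto_ae atTop (f := fun s a => ∑ i ∈ s, F i a)
      (fun s => Finset.aestronglyMeasurable_fun_sum s fun i _ => (hF i).1) hg
  refine ⟨hmeas, ?_⟩
  calc ∫⁻ a, ‖g a‖ₑ ∂μ
      ≤ ∫⁻ a, ∑' i, ‖F i a‖ₑ ∂μ := by
        refine lintegral_mono_ae (hg.mono fun a ha => ?_)
        rw [← ha.tsum_eq]
        exact enorm_tsum_le_tsum_enorm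
    _ = ∑' i, ENNReal.ofReal (∫ a, ‖F i a‖ ∂μ) := by
        rw [lintegral_tsum fun i => (hF i).1.enorm]
        exact tsum_congr fun i => (ofReal_integral_norm_eq_lintegral_enorm (hF i)).symm
    _ < ⊤ := by
        rw [← ENNReal.ofReal_tsum_of_nonneg (fun i => integral_nonneg fun _ => norm_nonneg _)
          hsummable]
        exact ENNReal.ofReal_lt_top

end SeriesIntegral

section QuasiPeriodic

/-- The quasi-periodicity under `t ↦ q t` of the function `t ↦ 1 / Θ_q(c t)` on the positive
axis, in the form that holds for all integral powers of `q`. -/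
def IsThetaQuasiPeriodic (q : ℝ) (c : ℂ) (W : ℝ → ℂ) : Prop :=
  ∀ (j : ℤ) (t : ℝ), 0 < t → W (q ^ j * t) = thetaTerm (q : ℂ) (c * t) (-j) * W t

namespace IsThetaQuasiPeriodic

variable {q : ℝ} {c : ℂ} {W : ℝ → ℂ}

theorem inv_jacobiThetaQ (hq : 1 < q) (hc : c ≠ 0) :
    IsThetaQuasiPeriodic q c fun t => (jacobiThetaQ q (c * t))⁻¹ := by
  intro j t ht
  have hct : c * t ≠ 0 := mul_ne_zero hc (Complex.ofReal_ne_zero.2 ht.ne')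
  have hq0 : (q : ℂ) ≠ 0 := Complex.ofReal_ne_zero.2 (zero_lt_one.trans hq).ne'
  dsimp only
  rw [← thetaTerm_neg_mul_jacobiThetaQ hq hct j, mul_inv,
    mul_inv_cancel_left₀ (thetaTerm_ne_zero hq0 hct _)]
  push_cast
  rw [mul_left_comm]

theorem norm (hq : 0 ≤ q) (hW : IsThetaQuasiPeriodic q c W) :
    IsThetaQuasiPeriodic q ‖c‖ fun t => (‖W t‖ : ℂ) := by
  intro j t ht
  dsimp only
  rw [hW j t ht, norm_mul, norm_thetaTerm_ofReal hq, norm_mul, Complex.norm_of_nonneg ht.le]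
  push_cast [ofReal_thetaTerm]
  rfl

theorem pow_mul (hW : IsThetaQuasiPeriodic q c W) (n : ℕ) :
    IsThetaQuasiPeriodic q ((q : ℂ) ^ (-n : ℤ) * c) fun t => (t : ℂ) ^ n * W t := by
  intro j t ht
  have hpow : ((q : ℂ) ^ (-n : ℤ)) ^ (-j) = ((q : ℂ) ^ j) ^ n := by
    rw [← zpow_mul, neg_mul_neg, mul_comm, zpow_mul, zpow_natCast]
  dsimp only
  rw [hW j t ht, mul_assoc _ c, thetaTerm_mul _ ((q : ℂ) ^ (-n : ℤ)), hpow]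
  push_cast
  ring

theorem zpow_smul (hW : IsThetaQuasiPeriodic q c W) (j : ℤ) {t : ℝ} (ht : 0 < t) :
    q ^ j • W (q ^ j * t) = thetaTerm (q : ℂ) ((q : ℂ)⁻¹ * c * t) (-j) * W t := by
  rw [hW j t ht, mul_assoc _ c, thetaTerm_mul _ (q : ℂ)⁻¹, inv_zpow', neg_neg, Complex.real_smul]
  push_cast
  ring

theorem exists_summable_bound (hq : 1 < q) (hc : c ≠ 0) (hW : IsThetaQuasiPeriodic q c W)
    (hcont : ContinuousOn W (Set.Ioi 0)) :
    ∃ b : ℤ → ℝ, Summable b ∧ ∀ j, ∀ s ∈ Set.Icc 1 q, ‖q ^ j • W (q ^ j * s)‖ ≤ b j := by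
  have hq0 : 0 < q := zero_lt_one.trans hq
  obtain ⟨M, hM⟩ := isCompact_Icc.exists_bound_of_continuousOn
    (hcont.mono fun s (hs : s ∈ Set.Icc 1 q) => zero_lt_one.trans_le hs.1)
  set a : ℝ := ‖(q : ℂ)⁻¹ * c‖
  have ha : 0 < a :=
    norm_pos_iff.2 (mul_ne_zero (inv_ne_zero (Complex.ofReal_ne_zero.2 hq0.ne')) hc)
  have hsummable {x : ℝ} (hx : 0 ≤ x) : Summable fun j : ℤ => thetaTerm q x (-j) :=
    (Equiv.neg ℤ).summable_iff.2 (summable_thetaTerm_real hq hx)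
  refine ⟨fun j => (thetaTerm q a (-j) + thetaTerm q (a * q) (-j)) * M,
    ((hsummable ha.le).add (hsummable (by positivity))).mul_right M, fun j s hs => ?_⟩
  have hs0 : 0 < s := zero_lt_one.trans_le hs.1
  have has : a * s ∈ Set.Icc a (a * q) :=
    ⟨le_mul_of_one_le_right ha.le hs.1, mul_le_mul_of_nonneg_left hs.2 ha.le⟩
  rw [hW.zpow_smul j hs0, norm_mul, norm_thetaTerm_ofReal hq0.le, norm_mul,
    Complex.norm_of_nonneg hs0.le]
  exact mul_le_mul (thetaTerm_le_add_of_mem_Icc hq0.le ha has _) (hM s hs) (norm_nonneg _)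
    (add_nonneg (thetaTerm_nonneg hq0.le ha.le _) (thetaTerm_nonneg hq0.le (by positivity) _))

theorem integrableOn_Ioi (hq : 1 < q) (hc : c ≠ 0) (hW : IsThetaQuasiPeriodic q c W)
    (hcont : ContinuousOn W (Set.Ioi 0)) : IntegrableOn W (Set.Ioi 0) := by
  obtain ⟨b, hb, hbound⟩ := hW.exists_summable_bound hq hc hcont
  exact integrableOn_Ioi_of_summable_bound hq hcont hb hbound

theorem integral_Ioi (hq : 1 < q) (hc : c ≠ 0) (hW : IsThetaQuasiPeriodic q c W)
    (hcont : ContinuousOn W (Set.Ioi 0)) :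
    ∫ t in Set.Ioi 0, W t = ∫ s in (1 : ℝ)..q, jacobiThetaQ q ((q : ℂ)⁻¹ * c * s) * W s := by
  obtain ⟨b, hb, hbound⟩ := hW.exists_summable_bound hq hc hcont
  refine integral_Ioi_eq_intervalIntegral_of_hasSum hq hcont hb hbound fun s hs => ?_
  simp only [hW.zpow_smul _ (zero_lt_one.trans_le hs.1)]
  exact ((Equiv.neg ℤ).hasSum_iff.2 (hasSum_jacobiThetaQ hq _)).mul_right _

theorem integrableOn_pow_mul (hq : 1 < q) (hc : c ≠ 0) (hW : IsThetaQuasiPeriodic q c W)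
    (hcont : ContinuousOn W (Set.Ioi 0)) (n : ℕ) :
    IntegrableOn (fun t : ℝ => (t : ℂ) ^ n * W t) (Set.Ioi 0) := by
  have hq0 : (q : ℂ) ≠ 0 := Complex.ofReal_ne_zero.2 (zero_lt_one.trans hq).ne'
  exact (hW.pow_mul n).integrableOn_Ioi hq (mul_ne_zero (zpow_ne_zero _ hq0) hc)
    (Continuous.continuousOn (by fun_prop) |>.mul hcont)

theorem integral_pow_mul (hq : 1 < q) (hc : c ≠ 0) (hW : IsThetaQuasiPeriodic q c W)
    (hcont : ContinuousOn W (Set.Ioi 0)) (n : ℕ) :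
    ∫ t in Set.Ioi (0 : ℝ), (t : ℂ) ^ n * W t = (thetaTerm (q : ℂ) c (n + 1))⁻¹ *
      ∫ s in (1 : ℝ)..q, jacobiThetaQ q (c * s) * W s / s := by
  have hq0 : (q : ℂ) ≠ 0 := Complex.ofReal_ne_zero.2 (zero_lt_one.trans hq).ne'
  rw [(hW.pow_mul n).integral_Ioi hq (mul_ne_zero (zpow_ne_zero _ hq0) hc)
    (Continuous.continuousOn (by fun_prop) |>.mul hcont), ← intervalIntegral.integral_const_mul]
  refine intervalIntegral.integral_congr fun s hs => ?_
  rw [Set.uIcc_of_le hq.le] at hs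
  have hs0 : (s : ℂ) ≠ 0 := Complex.ofReal_ne_zero.2 (zero_lt_one.trans_le hs.1).ne'
  have hpoint : (q : ℂ)⁻¹ * ((q : ℂ) ^ (-n : ℤ) * c) * s =
      (q : ℂ) ^ (-(n + 1) : ℤ) * (c * s) := by
    rw [neg_add, zpow_add₀ hq0, zpow_neg_one]
    ring
  have hterm := thetaTerm_ne_zero hq0 hc (n + 1)
  have hshift := thetaTerm_neg_mul_jacobiThetaQ hq (mul_ne_zero hc hs0) (-(n + 1))
  rw [neg_neg, mul_comm c, thetaTerm_mul, ← Nat.cast_succ, zpow_natCast, Nat.cast_succ,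
    pow_succ] at hshift
  rw [hpoint, mul_comm c, ← hshift]
  field_simp

theorem exists_integral_norm_pow_mul (hq : 1 < q) (hc : c ≠ 0) (hW : IsThetaQuasiPeriodic q c W)
    (hcont : ContinuousOn W (Set.Ioi 0)) :
    ∃ B : ℝ, ∀ n : ℕ,
      ∫ t in Set.Ioi (0 : ℝ), ‖(t : ℂ) ^ n * W t‖ = (thetaTerm q ‖c‖ (n + 1))⁻¹ * B := by
  have hcont' : ContinuousOn (fun t => (‖W t‖ : ℂ)) (Set.Ioi 0) :=
    Complex.continuous_ofReal.comp_continuousOn hcont.norm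
  have hmoment := (hW.norm (zero_lt_one.trans hq).le).integral_pow_mul hq
    (Complex.ofReal_ne_zero.2 (norm_ne_zero_iff.2 hc)) hcont'
  refine ⟨(∫ s in (1 : ℝ)..q, jacobiThetaQ q (‖c‖ * s) * ‖W s‖ / s).re, fun n => ?_⟩
  have hcast : ((∫ t in Set.Ioi (0 : ℝ), ‖(t : ℂ) ^ n * W t‖ : ℝ) : ℂ) =
      ∫ t in Set.Ioi (0 : ℝ), (t : ℂ) ^ n * (‖W t‖ : ℂ) := by
    rw [← integral_complex_ofReal]
    refine setIntegral_congr_fun measurableSet_Ioi fun t ht => ?_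
    simp only [norm_mul, norm_pow, Complex.norm_of_nonneg (Set.mem_Ioi.1 ht).le]
    push_cast
    rfl
  rw [hmoment n, ← ofReal_thetaTerm, ← Complex.ofReal_inv] at hcast
  simpa only [Complex.ofReal_re, Complex.re_ofReal_mul] using congrArg Complex.re hcast

section QExpE

variable {a : ℂ} {k : ℕ}

theorem summable_integral_norm_thetaTerm_mul (hq : 1 < q) (hW : IsThetaQuasiPeriodic q c W)
    (hcont : ContinuousOn W (Set.Ioi 0)) (hac : q ^ (k + 1) * ‖a‖ < ‖c‖) :
    Summable fun n : ℕ =>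
      ∫ t in Set.Ioi (0 : ℝ), ‖thetaTerm (q : ℂ) a n * ((t : ℂ) ^ (n + k) * W t)‖ := by
  have hq0 : 0 < q := zero_lt_one.trans hq
  have hc : 0 < ‖c‖ := lt_of_le_of_lt (by positivity) hac
  obtain ⟨B, hB⟩ := hW.exists_integral_norm_pow_mul hq (norm_pos_iff.1 hc) hcont
  have hgeom : Summable fun n : ℕ => (thetaTerm q ‖c‖ (k + 1))⁻¹ *
      (q ^ (k + 1) * ‖a‖ / ‖c‖) ^ n * B :=
    ((summable_geometric_of_lt_one (by positivity) ((div_lt_one hc).2 hac)).mul_left _).mul_right B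
  refine hgeom.congr fun n => ?_
  have hratio := thetaTerm_mul_inv_thetaTerm_add hq0.ne' hc.ne' ‖a‖ n (k + 1)
  simp only [norm_mul (thetaTerm (q : ℂ) a n), integral_const_mul, hB,
    norm_thetaTerm_ofReal hq0.le]
  rw [← mul_assoc, Nat.cast_add, add_assoc, hratio]
  norm_cast

theorem integrableOn_pow_mul_qExpE_mul (hq : 1 < q) (hW : IsThetaQuasiPeriodic q c W)
    (hcont : ContinuousOn W (Set.Ioi 0)) (hac : q ^ (k + 1) * ‖a‖ < ‖c‖) :
    IntegrableOn (fun t : ℝ => (t : ℂ) ^ k * qExpE q (a * t) * W t) (Set.Ioi 0) := by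
  have hc : c ≠ 0 := norm_pos_iff.1 (lt_of_le_of_lt (by positivity) hac)
  exact integrable_of_hasSum_of_summable_integral_norm
    (fun n => (hW.integrableOn_pow_mul hq hc hcont (n + k)).const_mul _)
    (hW.summable_integral_norm_thetaTerm_mul hq hcont hac)
    (Eventually.of_forall fun t => hasSum_pow_mul_qExpE_mul hq a k t (W t))

theorem integral_pow_mul_qExpE_mul (hq : 1 < q) (hW : IsThetaQuasiPeriodic q c W)
    (hcont : ContinuousOn W (Set.Ioi 0)) (hac : q ^ (k + 1) * ‖a‖ < ‖c‖) :
    ∫ t in Set.Ioi (0 : ℝ), (t : ℂ) ^ k * qExpE q (a * t) * W t =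
      (thetaTerm (q : ℂ) c (k + 1))⁻¹ * (1 - (q : ℂ) ^ (k + 1) * a / c)⁻¹ *
        ∫ s in (1 : ℝ)..q, jacobiThetaQ q (c * s) * W s / s := by
  have hq0 : 0 < q := zero_lt_one.trans hq
  have hc0 : 0 < ‖c‖ := lt_of_le_of_lt (by positivity) hac
  have hc : c ≠ 0 := norm_pos_iff.1 hc0
  have hterm (n : ℕ) : ∫ t in Set.Ioi (0 : ℝ), thetaTerm (q : ℂ) a n * ((t : ℂ) ^ (n + k) * W t) =
      (thetaTerm (q : ℂ) c (k + 1))⁻¹ * ((q : ℂ) ^ (k + 1) * a / c) ^ n *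
        ∫ s in (1 : ℝ)..q, jacobiThetaQ q (c * s) * W s / s := by
    have hratio := thetaTerm_mul_inv_thetaTerm_add (Complex.ofReal_ne_zero.2 hq0.ne') hc a n (k + 1)
    rw [integral_const_mul, hW.integral_pow_mul hq hc hcont, ← mul_assoc, Nat.cast_add, add_assoc,
      hratio]
    norm_cast
  have hratio_lt : ‖(q : ℂ) ^ (k + 1) * a / c‖ < 1 := by
    rwa [norm_div, norm_mul, norm_pow, Complex.norm_of_nonneg hq0.le, div_lt_one hc0]
  have hsum := hasSum_integral_of_summable_integral_norm
    (fun n => (hW.integrableOn_pow_mul hq hc hcont (n + k)).const_mul (thetaTerm (q : ℂ) a n))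
    (hW.summable_integral_norm_thetaTerm_mul hq hcont hac)
  simp only [hterm, (hasSum_pow_mul_qExpE_mul hq a k _ _).tsum_eq] at hsum
  exact hsum.unique (((hasSum_geometric_of_norm_lt_one hratio_lt).mul_left _).mul_right _)

end QExpE

end IsThetaQuasiPeriodic

end QuasiPeriodic

section RayIntegral

variable {q : ℝ}

theorem jacobiThetaQ_ne_zero (hq : 1 < q) {z : ℂ} (hz : z ∈ Complex.slitPlane) :
    jacobiThetaQ q z ≠ 0 := by
  rw [← (hasSum_jacobiThetaQ hq z).tsum_eq]
  refine tsum_thetaTerm_ne_zero (one_lt_norm_ofReal hq) (Complex.slitPlane_ne_zero hz) ?_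
  rintro j rfl
  rw [← Complex.ofReal_zpow, Complex.neg_ofReal_mem_slitPlane] at hz
  exact (zpow_pos (zero_lt_one.trans hq) j).not_gt hz

theorem AdmissibleDirection.mul_mem_slitPlane {ω : ℂ} {θ s : ℝ} (h : AdmissibleDirection ω θ)
    (hω : ω ≠ 0) (hs : 0 < s) : s * (ω * Complex.exp (θ * Complex.I)) ∈ Complex.slitPlane := by
  have hexp : Complex.exp (θ * Complex.I) ≠ 0 := Complex.exp_ne_zero _
  rw [Complex.mem_slitPlane_iff_arg, Complex.arg_real_mul _ hs]
  refine ⟨fun harg => ?_, mul_ne_zero (Complex.ofReal_ne_zero.2 hs.ne') (mul_ne_zero hω hexp)⟩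
  have hangle := Complex.arg_mul_coe_angle hω hexp
  rw [harg, Complex.arg_exp_mul_I, Real.Angle.coe_toIocMod, ← Real.Angle.coe_add, eq_comm,
    Real.Angle.angle_eq_iff_two_pi_dvd_sub] at hangle
  obtain ⟨n, hn⟩ := hangle
  exact h n (by linear_combination hn)

theorem continuousOn_inv_jacobiThetaQ_mul (hq : 1 < q) {c : ℂ}
    (hc : ∀ t : ℝ, 0 < t → c * t ∈ Complex.slitPlane) :
    ContinuousOn (fun t : ℝ => (jacobiThetaQ q (c * t))⁻¹) (Set.Ioi 0) :=
  ((continuousOn_jacobiThetaQ hq).comp (Continuous.continuousOn (by fun_prop))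
    fun t ht => Complex.slitPlane_ne_zero (hc t ht)).inv₀
      fun t ht => jacobiThetaQ_ne_zero hq (hc t ht)

theorem integral_jacobiThetaQ_mul_inv_div (hq : 1 < q) {c : ℂ}
    (hc : ∀ t : ℝ, 0 < t → c * t ∈ Complex.slitPlane) :
    ∫ s in (1 : ℝ)..q, jacobiThetaQ q (c * s) * (jacobiThetaQ q (c * s))⁻¹ / s = Real.log q := by
  have hcancel : ∫ s in (1 : ℝ)..q, jacobiThetaQ q (c * s) * (jacobiThetaQ q (c * s))⁻¹ / s =
      ∫ s in (1 : ℝ)..q, ((s⁻¹ : ℝ) : ℂ) := by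
    refine intervalIntegral.integral_congr fun s hs => ?_
    rw [Set.uIcc_of_le hq.le] at hs
    rw [mul_inv_cancel₀ (jacobiThetaQ_ne_zero hq (hc s (zero_lt_one.trans_le hs.1))),
      Complex.ofReal_inv, one_div]
  rw [hcancel, intervalIntegral.integral_ofReal,
    integral_inv_of_pos one_pos (zero_lt_one.trans hq), div_one]

theorem qKernel_mul_exp (k : ℕ) (z ω : ℂ) (t θ : ℝ) :
    qKernel q k z ω (t * Complex.exp (θ * Complex.I)) * Complex.exp (θ * Complex.I) =
      Complex.exp (θ * Complex.I) ^ (k + 1) *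
        (t ^ k * qExpE q (z * Complex.exp (θ * Complex.I) * t) *
          (jacobiThetaQ q (q * ω * Complex.exp (θ * Complex.I) * t))⁻¹) := by
  rw [qKernel, mul_comm (t : ℂ), ← mul_assoc z, ← mul_assoc (q * ω)]
  ring

variable {k : ℕ} {z ω : ℂ} {θ : ℝ}

theorem AdmissibleDirection.mul_ray_mem_slitPlane (hq : 0 < q) (hω : ω ≠ 0)
    (hθ : AdmissibleDirection ω θ) {t : ℝ} (ht : 0 < t) :
    q * ω * Complex.exp (θ * Complex.I) * t ∈ Complex.slitPlane := by
  have h := hθ.mul_mem_slitPlane hω (mul_pos hq ht)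
  rw [Complex.ofReal_mul] at h
  convert! h using 1
  ring

theorem pow_succ_mul_norm_mul_exp_lt (hq : 0 < q) (hz : q ^ k * ‖z‖ < ‖ω‖) (θ : ℝ) :
    q ^ (k + 1) * ‖z * Complex.exp (θ * Complex.I)‖ <
      ‖q * ω * Complex.exp (θ * Complex.I)‖ := by
  rw [norm_mul, norm_mul, norm_mul, Complex.norm_exp_ofReal_mul_I, Complex.norm_of_nonneg hq.le,
    mul_one, mul_one, pow_succ', mul_assoc]
  exact mul_lt_mul_of_pos_left hz hq

theorem rayIntegrable_qKernel (hq : 1 < q) (hz : q ^ k * ‖z‖ < ‖ω‖)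
    (hθ : AdmissibleDirection ω θ) : RayIntegrable θ (qKernel q k z ω) := by
  have hq0 : 0 < q := zero_lt_one.trans hq
  have hω : ω ≠ 0 := norm_pos_iff.1 (lt_of_le_of_lt (by positivity) hz)
  have hc (t : ℝ) (ht : 0 < t) := hθ.mul_ray_mem_slitPlane hq0 hω ht
  have hc0 : q * ω * Complex.exp (θ * Complex.I) ≠ 0 :=
    left_ne_zero_of_mul (Complex.slitPlane_ne_zero (hc 1 one_pos))
  simp only [RayIntegrable, qKernel_mul_exp]
  exact ((IsThetaQuasiPeriodic.inv_jacobiThetaQ hq hc0).integrableOn_pow_mul_qExpE_mul hq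
    (continuousOn_inv_jacobiThetaQ_mul hq hc) (pow_succ_mul_norm_mul_exp_lt hq0 hz θ)).const_mul _

theorem rayIntegral_qKernel (hq : 1 < q) (hz : q ^ k * ‖z‖ < ‖ω‖)
    (hθ : AdmissibleDirection ω θ) :
    rayIntegral θ (qKernel q k z ω) =
      Real.log q / q * ((thetaTerm (q : ℂ) ω k)⁻¹ * (ω - (q : ℂ) ^ k * z)⁻¹) := by
  have hq0 : 0 < q := zero_lt_one.trans hq
  have hqC : (q : ℂ) ≠ 0 := Complex.ofReal_ne_zero.2 hq0.ne'
  have hω : ω ≠ 0 := norm_pos_iff.1 (lt_of_le_of_lt (by positivity) hz)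
  have hc (t : ℝ) (ht : 0 < t) := hθ.mul_ray_mem_slitPlane hq0 hω ht
  have hintegral := (IsThetaQuasiPeriodic.inv_jacobiThetaQ hq
    (left_ne_zero_of_mul (Complex.slitPlane_ne_zero (hc 1 one_pos)))).integral_pow_mul_qExpE_mul hq
    (continuousOn_inv_jacobiThetaQ_mul hq hc) (pow_succ_mul_norm_mul_exp_lt hq0 hz θ)
  simp only [integral_jacobiThetaQ_mul_inv_div hq hc] at hintegral
  simp only [rayIntegral, qKernel_mul_exp, integral_const_mul, hintegral]
  generalize hexp : Complex.exp (θ * Complex.I) = e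
  have he : e ≠ 0 := hexp ▸ Complex.exp_ne_zero _
  have hterm : thetaTerm (q : ℂ) (q * ω * e) (k + 1) =
      e ^ (k + 1) * (q * ω * thetaTerm (q : ℂ) ω k) := by
    rw [mul_comm _ e, thetaTerm_mul, thetaTerm_mul, thetaTerm_add_one hqC hω, zpow_add_one₀ hqC]
    field_simp
    norm_cast
    ring
  have hgeom : 1 - (q : ℂ) ^ (k + 1) * (z * e) / (q * ω * e) = (ω - (q : ℂ) ^ k * z) / ω := by
    field_simp
    ring
  rw [hterm, hgeom]
  field_simp

end RayIntegral

section Growth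

variable {q x : ℝ}

/-- The function `x ↦ exp (log² x / (2 log q)) x ^ (1 / 2)` of the growth bound with exponent
`1 / 2`, the exponent for which it has the quasi-periodicity of `Θ_q` on the positive axis. -/
noncomputable def gaussWeight (q x : ℝ) : ℝ :=
  Real.exp (Real.log x ^ 2 / (2 * Real.log q)) * x ^ (1 / 2 : ℝ)

theorem one_le_gaussWeight (hq : 1 < q) (hx : 1 ≤ x) : 1 ≤ gaussWeight q x := by
  have hlog : 0 < Real.log q := Real.log_pos hq
  exact one_le_mul_of_one_le_of_one_le (Real.one_le_exp (by positivity))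
    (Real.one_le_rpow hx (by norm_num))

theorem thetaTerm_eq_exp (hq : 0 < q) (hx : 0 < x) (m : ℤ) :
    thetaTerm q x m = Real.exp (m * Real.log x - m * (m - 1) / 2 * Real.log q) := by
  have htri : (((m * (m - 1) / 2 : ℤ)) : ℝ) = m * (m - 1) / 2 := by
    rw [eq_div_iff two_ne_zero, mul_comm]
    exact_mod_cast two_mul_triangular m
  rw [thetaTerm, Real.exp_sub, ← htri, mul_comm (m : ℝ), mul_comm ((_ : ℤ) : ℝ) (Real.log q),
    Real.exp_mul, Real.exp_mul, Real.exp_log hx, Real.exp_log hq, Real.rpow_intCast,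
    Real.rpow_intCast]

theorem thetaTerm_neg_mul_gaussWeight (hq : 1 < q) (hx : 0 < x) (j : ℤ) :
    thetaTerm q x (-j) * gaussWeight q (q ^ j * x) = gaussWeight q x := by
  have hq0 : 0 < q := zero_lt_one.trans hq
  have hlog : Real.log q ≠ 0 := (Real.log_pos hq).ne'
  have hqj : 0 < q ^ j := zpow_pos hq0 j
  rw [gaussWeight, gaussWeight, thetaTerm_eq_exp hq0 hx, Real.rpow_def_of_pos (mul_pos hqj hx),
    Real.rpow_def_of_pos hx, ← Real.exp_add, ← Real.exp_add, ← Real.exp_add,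
    Real.log_mul hqj.ne' hx.ne', Real.log_zpow]
  congr 1
  push_cast
  field_simp
  ring

theorem tsum_thetaTerm_le_mul_gaussWeight (hq : 1 < q) (hx : 0 < x) :
    ∑' m : ℤ, thetaTerm q x m ≤ (∑' m : ℤ, (thetaTerm q 1 m + thetaTerm q q m)) *
      gaussWeight q x := by
  have hq0 : 0 < q := zero_lt_one.trans hq
  obtain ⟨j, hj⟩ := exists_mem_Ico_zpow hx hq
  obtain ⟨y, rfl⟩ : ∃ y, x = q ^ j * y := ⟨(q ^ j)⁻¹ * x, by field_simp⟩
  have hqj : 0 < q ^ j := zpow_pos hq0 j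
  have hy : y ∈ Set.Icc 1 q := by
    rw [zpow_add_one₀ hq0.ne'] at hj
    exact ⟨le_of_mul_le_mul_left (by simpa using hj.1) hqj, (lt_of_mul_lt_mul_left hj.2 hqj.le).le⟩
  have hy0 : 0 < y := zero_lt_one.trans_le hy.1
  have hpos : 0 < thetaTerm q y (-j) := div_pos (zpow_pos hy0 _) (zpow_pos hq0 _)
  have hsummable := (summable_thetaTerm_real hq zero_le_one).add (summable_thetaTerm_real hq hq0.le)
  refine le_of_mul_le_mul_left ?_ hpos
  calc thetaTerm q y (-j) * ∑' m : ℤ, thetaTerm q (q ^ j * y) m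
      = ∑' m : ℤ, thetaTerm q y m := thetaTerm_neg_mul_tsum_thetaTerm hq0.ne' hy0.ne' j
    _ ≤ ∑' m : ℤ, (thetaTerm q 1 m + thetaTerm q q m) :=
        (summable_thetaTerm_real hq hy0.le).tsum_le_tsum
          (thetaTerm_le_add_of_mem_Icc hq0.le one_pos hy) hsummable
    _ ≤ (∑' m : ℤ, (thetaTerm q 1 m + thetaTerm q q m)) * gaussWeight q y :=
        le_mul_of_one_le_right (tsum_nonneg fun m => add_nonneg
          (thetaTerm_nonneg hq0.le zero_le_one m) (thetaTerm_nonneg hq0.le hq0.le m))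
          (one_le_gaussWeight hq hy.1)
    _ = _ := by rw [← thetaTerm_neg_mul_gaussWeight hq hy0 j, mul_left_comm]

theorem norm_qExpE_le_tsum_thetaTerm (hq : 1 < q) (z : ℂ) :
    ‖qExpE q z‖ ≤ ∑' m : ℤ, thetaTerm q ‖z‖ m := by
  have hq0 : 0 ≤ q := zero_le_one.trans hq.le
  have hsummable := summable_thetaTerm_real hq (norm_nonneg z)
  rw [← (hasSum_qExpE hq z).tsum_eq]
  refine (tsum_of_norm_bounded (hsummable.comp_injective Nat.cast_injective).hasSum
    fun n => (norm_thetaTerm_ofReal hq0 z n).le).trans ?_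
  exact tsum_comp_le_tsum_of_inj hsummable (thetaTerm_nonneg hq0 (norm_nonneg z)) Nat.cast_injective

theorem isGrowthExponent_half (hq : 1 < q) : IsGrowthExponent q (1 / 2) := by
  have hq0 : 0 < q := zero_lt_one.trans hq
  have hsummable := (summable_thetaTerm_real hq zero_le_one).add (summable_thetaTerm_real hq hq0.le)
  refine ⟨∑' m : ℤ, (thetaTerm q 1 m + thetaTerm q q m), ?_, fun z hz => ?_⟩
  · refine hsummable.tsum_pos (fun m => add_nonneg (thetaTerm_nonneg hq0.le zero_le_one m)
      (thetaTerm_nonneg hq0.le hq0.le m)) 0 ?_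
    simp only [thetaTerm_zero, add_pos zero_lt_one zero_lt_one]
  · rw [mul_assoc]
    exact (norm_qExpE_le_tsum_thetaTerm hq z).trans
      (tsum_thetaTerm_le_mul_gaussWeight hq (norm_pos_iff.2 hz))

end Growth

section MomentDerivative

theorem coeff_iterate_momentDeriv {m : ℕ → ℝ} (hm : ∀ n, m n ≠ 0) (φ : PowerSeries ℂ) (k n : ℕ) :
    PowerSeries.coeff n ((momentDeriv m)^[k] φ) =
      ((m (n + k) / m n : ℝ) : ℂ) * PowerSeries.coeff (n + k) φ := by
  induction k generalizing φ with
  | zero => simp [hm n]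
  | succ k ih =>
    rw [Function.iterate_succ_apply, ih, momentDeriv, PowerSeries.coeff_mk, ← mul_assoc,
      ← Complex.ofReal_mul, mul_comm (_ / _), div_mul_div_cancel₀ (hm (n + k)), add_assoc]

variable {q : ℝ}

theorem mOne_ne_zero (hq : q ≠ 0) (n : ℕ) : mOne q n ≠ 0 :=
  pow_ne_zero _ hq

theorem thetaTerm_eq_pow_div_mOne (q : ℝ) (z : ℂ) (n : ℕ) :
    thetaTerm (q : ℂ) z n = z ^ n / mOne q n := by
  rw [thetaTerm_natCast, mOne, Complex.ofReal_pow]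

theorem mOne_add_div_mOne (hq : q ≠ 0) (n k : ℕ) :
    mOne q (n + k) / mOne q n = mOne q k * (q ^ k) ^ n := by
  have hmOne (m : ℕ) : mOne q m = (thetaTerm q 1 m)⁻¹ := by
    rw [thetaTerm_natCast, one_pow, one_div, inv_inv, mOne]
  have hn := thetaTerm_ne_zero hq one_ne_zero n
  rw [hmOne, hmOne, hmOne, Nat.cast_add, thetaTerm_add hq one_ne_zero, ← pow_mul, mul_comm k n]
  norm_cast
  field_simp

theorem coeff_iterate_momentDeriv_mOne (hq : q ≠ 0) (φ : PowerSeries ℂ) (k n : ℕ) :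
    PowerSeries.coeff n ((momentDeriv (mOne q))^[k] φ) =
      mOne q k * ((q : ℂ) ^ k) ^ n * PowerSeries.coeff (n + k) φ := by
  rw [coeff_iterate_momentDeriv (mOne_ne_zero hq), mOne_add_div_mOne hq]
  push_cast
  rfl

theorem coeff_momentDeriv_mOne (hq : q ≠ 0) (φ : PowerSeries ℂ) (n : ℕ) :
    PowerSeries.coeff n (momentDeriv (mOne q) φ) = (q : ℂ) ^ n * PowerSeries.coeff (n + 1) φ := by
  have h := coeff_iterate_momentDeriv_mOne hq φ 1 n
  rwa [Function.iterate_one, mOne, pow_zero, Complex.ofReal_one, one_mul, pow_one] at h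

theorem hasSum_mul_zero_pow (a : ℕ → ℂ) : HasSum (fun n => a n * 0 ^ n) (a 0) := by
  simpa using hasSum_single (f := fun n => a n * (0 : ℂ) ^ n) 0 fun n hn => by
    rw [zero_pow hn, mul_zero]

section HasSum

variable {g : ℂ → ℂ} {φ : PowerSeries ℂ} {R : ℝ}

theorem deriv_zero_eq_coeff_one (hR : 0 < R)
    (hg : ∀ z : ℂ, ‖z‖ < R → HasSum (fun n => PowerSeries.coeff n φ * z ^ n) (g z)) :
    deriv g 0 = PowerSeries.coeff 1 φ := by
  have hseries : HasFPowerSeriesAt g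
      (FormalMultilinearSeries.ofScalars ℂ fun n => PowerSeries.coeff n φ) 0 := by
    rw [hasFPowerSeriesAt_iff]
    filter_upwards [Metric.ball_mem_nhds (0 : ℂ) hR] with z hz
    rw [zero_add]
    refine (hg z (mem_ball_zero_iff.1 hz)).congr_fun fun n => ?_
    rw [FormalMultilinearSeries.coeff_ofScalars, smul_eq_mul, mul_comm]
  rw [hseries.deriv]
  simp [FormalMultilinearSeries.ofScalars]

theorem hasSum_tildeD (hq : 0 < q)
    (hg : ∀ z : ℂ, ‖z‖ < R → HasSum (fun n => PowerSeries.coeff n φ * z ^ n) (g z)) {z : ℂ}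
    (hz : q * ‖z‖ < R) :
    HasSum (fun n => PowerSeries.coeff n (momentDeriv (mOne q) φ) * z ^ n) (tildeD q g z) := by
  have hqC : (q : ℂ) ≠ 0 := Complex.ofReal_ne_zero.2 hq.ne'
  have hR : 0 < R := lt_of_le_of_lt (by positivity) hz
  rcases eq_or_ne z 0 with rfl | hz0
  · have h := hasSum_mul_zero_pow fun n => PowerSeries.coeff n (momentDeriv (mOne q) φ)
    rwa [coeff_momentDeriv_mOne hq.ne', pow_zero, one_mul, zero_add,
      ← deriv_zero_eq_coeff_one hR hg, ← if_pos (c := (0 : ℂ) = 0) (t := deriv g 0) rfl] at h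
  · rw [tildeD, if_neg hz0]
    have hg0 : g 0 = PowerSeries.coeff 0 φ :=
      (hg 0 (by rwa [norm_zero])).unique (hasSum_mul_zero_pow _)
    have hgq := hg (q * z) (by rwa [norm_mul, Complex.norm_of_nonneg hq.le])
    rw [← hasSum_nat_add_iff' 1] at hgq
    simp only [Finset.range_one, Finset.sum_singleton, pow_zero, mul_one, ← hg0] at hgq
    refine (hgq.div_const ((q : ℂ) * z)).congr_fun fun n => ?_
    rw [coeff_momentDeriv_mOne hq.ne']
    field_simp
    ring

theorem hasSum_iterate_tildeD (hq : 0 < q)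
    (hg : ∀ z : ℂ, ‖z‖ < R → HasSum (fun n => PowerSeries.coeff n φ * z ^ n) (g z)) (k : ℕ)
    {z : ℂ} (hz : q ^ k * ‖z‖ < R) :
    HasSum (fun n => PowerSeries.coeff n ((momentDeriv (mOne q))^[k] φ) * z ^ n)
      ((tildeD q)^[k] g z) := by
  induction k generalizing z with
  | zero => exact hg z (by simpa using hz)
  | succ k ih =>
    have hqk : 0 < q ^ k := pow_pos hq k
    rw [Function.iterate_succ_apply', Function.iterate_succ_apply']
    refine hasSum_tildeD hq (R := R / q ^ k) (fun w hw => ih ?_) ?_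
    · rwa [lt_div_iff₀' hqk] at hw
    · rwa [lt_div_iff₀' hqk, ← mul_assoc, ← pow_succ]

end HasSum

theorem pqDeriv_zero_left (q : ℝ) : pqDeriv 0 q = tildeD q := by
  funext f z
  rw [pqDeriv, tildeD, Complex.ofReal_zero, zero_mul, zero_sub, ← neg_sub (f (q * z)) (f 0),
    neg_div_neg_eq]

end MomentDerivative

section Maclaurin

variable {f : ℂ → ℂ} {ε : ℝ}

theorem hasSum_maclaurin (hf : DifferentiableOn ℂ f (Metric.ball 0 ε)) {z : ℂ} (hz : ‖z‖ < ε) :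
    HasSum (fun n => PowerSeries.coeff n (maclaurin f) * z ^ n) (f z) := by
  refine (Complex.hasSum_taylorSeries_on_ball hf (mem_ball_zero_iff.2 hz)).congr_fun fun n => ?_
  rw [maclaurin, PowerSeries.coeff_mk, sub_zero, smul_eq_mul, smul_eq_mul]
  ring

theorem coeff_maclaurin_eq_circleIntegral (hε : 0 < ε) (hf : DiffContOnCl ℂ f (Metric.ball 0 ε))
    (n : ℕ) : PowerSeries.coeff n (maclaurin f) =
      (2 * Real.pi * Complex.I : ℂ)⁻¹ * ∮ ω in C(0, ε), (ω ^ (n + 1))⁻¹ * f ω := by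
  have h := hf.circleIntegral_one_div_sub_center_pow_smul hε n
  simp only [sub_zero, one_div, smul_eq_mul] at h
  rw [h, maclaurin, PowerSeries.coeff_mk]
  have := Complex.two_pi_I_ne_zero
  field_simp

theorem hasSum_coeff_add_maclaurin (hf : DiffContOnCl ℂ f (Metric.ball 0 ε)) (k : ℕ) {w : ℂ}
    (hw : ‖w‖ < ε) :
    HasSum (fun n => PowerSeries.coeff (n + k) (maclaurin f) * w ^ n)
      ((2 * Real.pi * Complex.I : ℂ)⁻¹ * ∮ ω in C(0, ε), f ω * ((ω ^ k)⁻¹ * (ω - w)⁻¹)) := by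
  have hε : 0 < ε := (norm_nonneg w).trans_lt hw
  have hne {ω : ℂ} (hω : ω ∈ Metric.sphere (0 : ℂ) ε) : ω ≠ 0 :=
    ne_zero_of_mem_sphere hε.ne' ⟨ω, hω⟩
  have hcont : ContinuousOn (fun ω => (ω ^ k)⁻¹ * f ω) (Metric.sphere 0 ε) :=
    ((continuousOn_pow k).inv₀ fun ω hω => pow_ne_zero _ (hne hω)).mul
      (hf.continuousOn_ball.mono Metric.sphere_subset_closedBall)
  have h := hasSum_cauchyPowerSeries_integral (hcont.circleIntegrable hε.le) hw
  simp only [cauchyPowerSeries_apply, smul_eq_mul, zero_add, sub_zero] at h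
  convert! h using 1
  · funext n
    rw [coeff_maclaurin_eq_circleIntegral hε hf, mul_assoc, mul_comm _ (w ^ n),
      ← circleIntegral.integral_const_mul]
    congr 1
    refine circleIntegral.integral_congr hε.le fun ω hω => ?_
    have := hne hω
    simp only [div_pow]
    field_simp
    ring
  · congr 1
    exact circleIntegral.integral_congr hε.le fun ω _ => by ring

end Maclaurin

section Representation

variable {q ε : ℝ} {f : ℂ → ℂ} {k : ℕ} {z : ℂ} {θ : ℂ → ℝ}

theorem norm_ofReal_pow_mul (hq : 0 ≤ q) (k : ℕ) (z : ℂ) : ‖(q : ℂ) ^ k * z‖ = q ^ k * ‖z‖ := by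
  rw [norm_mul, norm_pow, Complex.norm_of_nonneg hq]

theorem ae_mul_rayIntegral_eq (hq : 1 < q) (hz : q ^ k * ‖z‖ < ε) (f : ℂ → ℂ)
    (hθ : {ω : ℂ | ‖ω‖ = ε ∧ ¬ AdmissibleDirection ω (θ ω)}.Countable) :
    ∀ᵐ t : ℝ, f (circleMap 0 ε t) * rayIntegral (θ (circleMap 0 ε t))
        (qKernel q k z (circleMap 0 ε t)) =
      mOne q k * Real.log q / q * (f (circleMap 0 ε t) *
        ((circleMap 0 ε t ^ k)⁻¹ * (circleMap 0 ε t - (q : ℂ) ^ k * z)⁻¹)) := by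
  have hε : 0 < ε := lt_of_le_of_lt (by positivity) hz
  filter_upwards [(hθ.preimage_circleMap 0 hε.ne').ae_notMem volume] with t ht
  have hnorm : ‖circleMap 0 ε t‖ = ε := by rw [norm_circleMap_zero, abs_of_pos hε]
  have hadm : AdmissibleDirection (circleMap 0 ε t) (θ (circleMap 0 ε t)) :=
    not_not.1 fun h => ht ⟨hnorm, h⟩
  rw [rayIntegral_qKernel hq (by rwa [hnorm]) hadm, thetaTerm_eq_pow_div_mOne, inv_div]
  ring

theorem continuousOn_mul_inv_pow_mul_inv_sub (hf : ContinuousOn f (Metric.sphere 0 ε)) (k : ℕ)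
    {w : ℂ} (hw : ‖w‖ < ε) :
    ContinuousOn (fun ω => f ω * ((ω ^ k)⁻¹ * (ω - w)⁻¹)) (Metric.sphere 0 ε) := by
  have hε : 0 < ε := (norm_nonneg w).trans_lt hw
  refine hf.mul (((continuousOn_pow k).inv₀ fun ω hω => ?_).mul
    ((continuousOn_id.sub continuousOn_const).inv₀ fun ω hω => ?_))
  · exact pow_ne_zero k (ne_zero_of_mem_sphere hε.ne' ⟨ω, hω⟩)
  · exact sub_ne_zero.2 <|
      ne_of_mem_of_not_mem hω fun h => hw.ne (mem_sphere_zero_iff_norm.1 h)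

theorem circleIntegrable_mul_rayIntegral (hq : 1 < q) (hz : q ^ k * ‖z‖ < ε)
    (hf : ContinuousOn f (Metric.sphere 0 ε))
    (hθ : {ω : ℂ | ‖ω‖ = ε ∧ ¬ AdmissibleDirection ω (θ ω)}.Countable) :
    CircleIntegrable (fun ω => f ω * rayIntegral (θ ω) (qKernel q k z ω)) 0 ε := by
  have hε : 0 < ε := lt_of_le_of_lt (by positivity) hz
  have hw : ‖(q : ℂ) ^ k * z‖ < ε := by rwa [norm_ofReal_pow_mul (zero_le_one.trans hq.le)]
  have hcont := (continuousOn_mul_inv_pow_mul_inv_sub hf k hw).const_mul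
    (mOne q k * Real.log q / q : ℂ)
  refine IntervalIntegrable.congr_ae (hcont.circleIntegrable hε.le) (ae_restrict_of_ae ?_)
  filter_upwards [ae_mul_rayIntegral_eq hq hz f hθ] with t ht using ht.symm

theorem qIntegralRep_eq_circleIntegral (hq : 1 < q) (hz : q ^ k * ‖z‖ < ε) (f : ℂ → ℂ)
    (hθ : {ω : ℂ | ‖ω‖ = ε ∧ ¬ AdmissibleDirection ω (θ ω)}.Countable) :
    qIntegralRep q k ε θ f z = mOne q k * ((2 * Real.pi * Complex.I : ℂ)⁻¹ *
      ∮ ω in C(0, ε), f ω * ((ω ^ k)⁻¹ * (ω - (q : ℂ) ^ k * z)⁻¹)) := by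
  have hqC : (q : ℂ) ≠ 0 := Complex.ofReal_ne_zero.2 (zero_lt_one.trans hq).ne'
  have hlog : (Real.log q : ℂ) ≠ 0 := Complex.ofReal_ne_zero.2 (Real.log_pos hq).ne'
  have hpi : (Real.pi : ℂ) ≠ 0 := Complex.ofReal_ne_zero.2 Real.pi_ne_zero
  have hintegral : (∮ ω in C(0, ε), f ω * rayIntegral (θ ω) (qKernel q k z ω)) =
      ∮ ω in C(0, ε), mOne q k * Real.log q / q *
        (f ω * ((ω ^ k)⁻¹ * (ω - (q : ℂ) ^ k * z)⁻¹)) := by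
    refine intervalIntegral.integral_congr_ae ?_
    filter_upwards [ae_mul_rayIntegral_eq hq hz f hθ] with t ht _
    rw [ht]
  rw [qIntegralRep, hintegral, circleIntegral.integral_const_mul]
  field_simp [Complex.I_ne_zero]

theorem hasSum_qIntegralRep (hq : 1 < q) (hz : q ^ k * ‖z‖ < ε)
    (hf : DiffContOnCl ℂ f (Metric.ball 0 ε))
    (hθ : {ω : ℂ | ‖ω‖ = ε ∧ ¬ AdmissibleDirection ω (θ ω)}.Countable) :
    HasSum
      (fun n : ℕ => PowerSeries.coeff n ((momentDeriv (mOne q))^[k] (maclaurin f)) * z ^ n)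
      (qIntegralRep q k ε θ f z) := by
  have hq0 : 0 < q := zero_lt_one.trans hq
  have hw : ‖(q : ℂ) ^ k * z‖ < ε := by rwa [norm_ofReal_pow_mul hq0.le]
  rw [qIntegralRep_eq_circleIntegral hq hz f hθ]
  refine ((hasSum_coeff_add_maclaurin hf k hw).mul_left (mOne q k : ℂ)).congr_fun fun n => ?_
  rw [coeff_iterate_momentDeriv_mOne hq0.ne', mul_pow]
  ring

end Representation

theorem theorem1_general {q : ℝ} (hq : 1 < q) {ε : ℝ} {f : ℂ → ℂ}
    (hf : DiffContOnCl ℂ f (Metric.ball 0 ε)) {k : ℕ} {z : ℂ} (hz : ‖z‖ < (q ^ k)⁻¹ * ε)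
    {θ : ℂ → ℝ} (hθ : {ω : ℂ | ‖ω‖ = ε ∧ ¬ AdmissibleDirection ω (θ ω)}.Countable) :
    (∀ ω : ℂ, ‖ω‖ = ε → AdmissibleDirection ω (θ ω) →
      RayIntegrable (θ ω) (qKernel q k z ω)) ∧
    CircleIntegrable (fun ω => f ω * rayIntegral (θ ω) (qKernel q k z ω)) 0 ε ∧
    (tildeD q)^[k] f z = qIntegralRep q k ε θ f z ∧
    (pqDeriv 0 q)^[k] f z = qIntegralRep q k ε θ f z ∧
    HasSum
      (fun n : ℕ => PowerSeries.coeff n ((momentDeriv (mOne q))^[k] (maclaurin f)) * z ^ n)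
      (qIntegralRep q k ε θ f z) := by
  have hq0 : 0 < q := zero_lt_one.trans hq
  rw [← div_eq_inv_mul, lt_div_iff₀' (pow_pos hq0 k)] at hz
  have hsum := hasSum_qIntegralRep hq hz hf hθ
  have htilde : (tildeD q)^[k] f z = qIntegralRep q k ε θ f z :=
    (hasSum_iterate_tildeD hq0 (fun _ hw => hasSum_maclaurin hf.differentiableOn hw) k hz).unique
      hsum
  exact ⟨fun ω hω hadm => rayIntegrable_qKernel hq (by rwa [hω]) hadm,
    circleIntegrable_mul_rayIntegral hq hz
      (hf.continuousOn_ball.mono Metric.sphere_subset_closedBall) hθ,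
    htilde, pqDeriv_zero_left q ▸ htilde, hsum⟩

theorem theorem1 (q : ℝ) (hq : 1 < q) :
    (∃ α : ℝ, IsGrowthExponent q α) ∧
    ∀ α : ℝ, IsGrowthExponent q α →
    ∀ (r : ℝ) (f : ℂ → ℂ), 0 < r → DifferentiableOn ℂ f (Metric.ball 0 r) →
    ∀ (ε : ℝ), 0 < ε → ε < r →
    ∀ (k : ℕ) (z : ℂ), ‖z‖ < (q ^ k)⁻¹ * ε * min 1 (q ^ (1 / 2 - α)) →
    ∀ θ : ℂ → ℝ,
      {ω : ℂ | ‖ω‖ = ε ∧ ¬ AdmissibleDirection ω (θ ω)}.Countable →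
      (∀ ω : ℂ, ‖ω‖ = ε → AdmissibleDirection ω (θ ω) →
        RayIntegrable (θ ω) (qKernel q k z ω)) ∧
      CircleIntegrable (fun ω => f ω * rayIntegral (θ ω) (qKernel q k z ω)) 0 ε ∧
      (tildeD q)^[k] f z = qIntegralRep q k ε θ f z ∧
      (pqDeriv 0 q)^[k] f z = qIntegralRep q k ε θ f z ∧
      HasSum
        (fun n : ℕ => PowerSeries.coeff n ((momentDeriv (mOne q))^[k] (maclaurin f)) * z ^ n)
        (qIntegralRep q k ε θ f z) :=
  ⟨⟨1 / 2, isGrowthExponent_half hq⟩, fun _ _ _ _ _ hf _ _ hεr _ _ hz _ hθ =>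
    theorem1_general hq (hf.diffContOnCl_ball (Metric.closedBall_subset_ball hεr))
      (hz.trans_le (mul_le_of_le_one_right (by positivity) (min_le_left _ _))) hθ⟩
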